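/- Let $N,d\in\mathbb N$. For $n\ge 1$ let $\Theta_n=(\mathbb R^{N+d}\times\mathbb R\times[0,2\pi])^n$, with elements $\theta=(a^i,b^i,\gamma^i)_{i=1,\dots,n}$. For $(x,z)\in\mathbb R^N\times\mathbb R^d$ define the one-qubit gates $$U_1^{(i)}(x,z)=H\,R_z(-b^i)\,R_z(-a^i_{N+d}z_d)\cdots R_z(-a^i_{N+1}z_1)\,R_z(-a^i_Nx_N)\cdots R_z(-a^i_1x_1)\,H,\qquad U_2^{(i)}=R_y(\gamma^i),$$ where $H=\frac1{\sqrt2}\begin{pmatrix}1&1\\1&-1\end{pmatrix}$ is the Hadamard gate and $$R_y(\gamma)=\begin{pmatrix}\cos\frac\gamma2&-\sin\frac\gamma2\\ \sin\frac\gamma2&\cos\frac\gamma2\end{pmatrix},\qquad R_z(\alpha)=\begin{pmatrix}e^{-\mathrm i\alpha/2}&0\\0&e^{\mathrm i\alpha/2}\end{pmatrix}.$$ Let $n_0\ge 0$ be the smallest natural number such that $4n+n_0$ is a power of two, and let $U_\theta(x,z)$ be the block diagonal unitary matrix of size $4n+n_0$ with diagonal blocks $U_1^{(1)}(x,z)\otimes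 U_2^{(1)},\dots,U_1^{(n)}(x,z)\otimes U_2^{(n)}$ and the identity block $\mathbf 1_{n_0\times n_0}$. Denote the computational basis states by $|0\rangle,\dots,|4n+n_0-1\rangle$, and let $V$ be a unitary matrix of the same size with $V|0\rangle=\frac1{\sqrt n}\sum_{i=0}^{n-1}|4i\rangle$ (such $V$ exist). For $m\in\{0,1,2,3\}$ let $\mathbb P_m^{n,\theta}(x,z)=\sum_{i=0}^{n-1}\bigl|\langle 4i+m|\,U_\theta(x,z)V\,|0\rangle\bigr|^2$ be the probability that a measurement of the state $U_\theta(x,z)V|0\rangle$ yields one of $m,4+m,\dots,4(n-1)+m$. For $R>0$ and $\theta=(\theta^1,\dots,\theta^N)\in\Theta_n^N$ define the quantum neural network $\bar F_R^{n,\theta}\colon\mathbb R^N\times\mathbb R^d\to\mathbb R^N$ by $$\bar F_{R,j}^{n,\theta}(x,z)=R-2R\bigl[\mathbb P_1^{n,\theta^j}(x,z)+\mathbb P_2^{n,\theta^j}(x,z)\bigr],\qquad j=1,\dots,N.$$ **Statement.** Let $F=(F_1,\dots,F_N)\colon\mathbb R^N\times\mathbb R^d\to\mathbb R^N$ be continuously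 differentiable. Then for every $\varepsilon>0$ and every compact $\mathcal X\subset\mathbb R^N\times\mathbb R^d$ there exist $n\ge1$, $R>0$ and $\theta\in\Theta_n^N$ such that, for every admissible choice of $V$ and every $j\in\{1,\dots,N\}$, the function $\bar F_{R,j}^{n,\theta}$ is differentiable and, for all $(x,z)\in\mathcal X$, $$|F_j(x,z)-\bar F_{R,j}^{n,\theta}(x,z)|+\|\nabla F_j(x,z)-\nabla\bar F_{R,j}^{n,\theta}(x,z)\|\le\varepsilon,$$ where $\|\cdot\|$ is the Euclidean norm; that is, the supremum over $\mathcal X$ of the left-hand side is at most $\varepsilon$. -/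

import Mathlib

open scoped Kronecker

noncomputable section

namespace RQNN

/-- The space `ℝ^N × ℝ^d` of pairs `(x, z)` (state, input), with the Euclidean norm. -/
abbrev StateInput (N d : ℕ) : Type :=
  WithLp 2 (EuclideanSpace ℝ (Fin N) × EuclideanSpace ℝ (Fin d))

/-! ### One-qubit gates -/

/-- Rotation around the `Y`-axis. -/
def Ry (γ : ℝ) : Matrix (Fin 2) (Fin 2) ℂ :=
  !![(Real.cos (γ / 2) : ℂ), -(Real.sin (γ / 2) : ℂ);
     (Real.sin (γ / 2) : ℂ), (Real.cos (γ / 2) : ℂ)]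

/-- Rotation around the `Z`-axis. -/
def Rz (α : ℝ) : Matrix (Fin 2) (Fin 2) ℂ :=
  !![Complex.exp (-Complex.I * (α / 2 : ℝ)), 0;
     0, Complex.exp (Complex.I * (α / 2 : ℝ))]

/-- The Hadamard gate. -/
def hadamard : Matrix (Fin 2) (Fin 2) ℂ :=
  ((1 / Real.sqrt 2 : ℝ) : ℂ) • !![1, 1; 1, -1]

/-! ### Circuit parameters -/

/-- The parameters `(a^i, b^i, γ^i) ∈ ℝ^{N+d} × ℝ × [0, 2π]` of one block. -/
structure BlockParams (N d : ℕ) where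
  a : Fin (N + d) → ℝ
  b : ℝ
  γ : ℝ
  γ_mem : γ ∈ Set.Icc 0 (2 * Real.pi)

/-- The parameter set `Θ = (ℝ^{N+d} × ℝ × [0, 2π])^n` of one circuit. -/
abbrev Params (N d n : ℕ) : Type := Fin n → BlockParams N d

/-- The gate
`H Rz(-b) Rz(-a_{N+d} z_d) ⋯ Rz(-a_{N+1} z_1) Rz(-a_N x_N) ⋯ Rz(-a_1 x_1) H`. -/
def gateU₁ {N d : ℕ} (t : BlockParams N d) (p : StateInput N d) :
    Matrix (Fin 2) (Fin 2) ℂ :=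
  hadamard * Rz (-t.b) *
    (List.ofFn fun k : Fin (N + d) =>
      Rz (-(t.a k * Fin.append (fun l => p.fst l) (fun l => p.snd l) k))).reverse.prod *
    hadamard

/-- The gate `Ry(γ)`. -/
def gateU₂ {N d : ℕ} (t : BlockParams N d) : Matrix (Fin 2) (Fin 2) ℂ := Ry t.γ

/-- The two-qubit gate `U₁ ⊗ U₂`; the basis state `|r⟩ ⊗ |s⟩` has the number `2 r + s`. -/
def gateUbar {N d : ℕ} (t : BlockParams N d) (p : StateInput N d) :
    Matrix (Fin 4) (Fin 4) ℂ :=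
  Matrix.reindex (finProdFinEquiv (m := 2) (n := 2)) (finProdFinEquiv (m := 2) (n := 2))
    (gateU₁ t p ⊗ₖ gateU₂ t)

/-! ### The circuit -/

/-- The smallest natural number `n₀` such that `4 n + n₀` is a power of two. -/
def padding (n : ℕ) : ℕ := sInf {m : ℕ | ∃ q : ℕ, n * 4 + m = 2 ^ q}

/-- The dimension `n_U = 4 n + n₀` of the state space of the circuit. -/
def dim (n : ℕ) : ℕ := n * 4 + padding n

/-- The dimension of the circuit is a power of two. -/
lemma exists_dim_eq_two_pow (n : ℕ) : ∃ q, dim n = 2 ^ q := by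
  have : (padding n) ∈ {m : ℕ | ∃ q : ℕ, n * 4 + m = 2 ^ q} :=
    Nat.sInf_mem ⟨2 ^ (n*4) - n*4, n*4, by
      have := (Nat.lt_two_pow_self (n := n*4)); omega⟩
  exact this

/-- The numbering of the basis states: index `k` of block `i` has the number `4 i + k`, and the
`n₀` remaining indices follow. -/
def indexEquiv (n : ℕ) : (Fin 4 × Fin n) ⊕ Fin (padding n) ≃ Fin (dim n) :=
  (Equiv.sumCongr ((Equiv.prodComm (Fin 4) (Fin n)).trans finProdFinEquiv)
    (Equiv.refl (Fin (padding n)))).trans finSumFinEquiv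

/-- The uniformly controlled gate `U_θ(x, z)`: block diagonal with blocks
`Ubar⁽¹⁾, …, Ubar⁽ⁿ⁾` and an identity block of size `n₀`. -/
def gateU {N d n : ℕ} (θ : Params N d n) (p : StateInput N d) :
    Matrix (Fin (dim n)) (Fin (dim n)) ℂ :=
  Matrix.reindex (indexEquiv n) (indexEquiv n)
    (Matrix.fromBlocks (Matrix.blockDiagonal fun i : Fin n => gateUbar (θ i) p) 0 0 1)

/-- The computational basis state `|k⟩`. -/
def ket (n k : ℕ) : Fin (dim n) → ℂ := fun r => if (r : ℕ) = k then 1 else 0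

/-- The state `n^{-1/2} ∑_{i < n} |4 i⟩`. -/
def preparedState (n : ℕ) : Fin (dim n) → ℂ :=
  ((1 / Real.sqrt n : ℝ) : ℂ) • ∑ i ∈ Finset.range n, ket n (4 * i)

/-- `V` is a unitary gate that maps `|0⟩` to `n^{-1/2} ∑_{i < n} |4 i⟩`. -/
def IsPreparationGate (n : ℕ) (V : Matrix (Fin (dim n)) (Fin (dim n)) ℂ) : Prop :=
  V ∈ Matrix.unitaryGroup (Fin (dim n)) ℂ ∧ V.mulVec (ket n 0) = preparedState n

lemma sum_ket (n : ℕ) (f : Fin (dim n) → ℂ) (k : ℕ) (hk : k < dim n) :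
    ∑ r, f r * ket n k r = f ⟨k, hk⟩ := by
  rw [Finset.sum_eq_single ⟨k, hk⟩]
  · simp [ket]
  · intro b _ hb
    have : (b : ℕ) ≠ k := fun h => hb (Fin.ext h)
    simp [ket, this]
  · simp

/-- Preparation gates exist. -/
theorem exists_isPreparationGate {n : ℕ} (hn : 0 < n) :
    ∃ V : Matrix (Fin (dim n)) (Fin (dim n)) ℂ, IsPreparationGate n V := by
  have hdim : 4 * n ≤ dim n := by unfold dim; omega
  have hlt : ∀ i ∈ Finset.range n, 4 * i < dim n := by
    intro i hi
    have := Finset.mem_range.1 hi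
    omega
  have hn0 : (n : ℂ) ≠ 0 := by exact_mod_cast hn.ne'
  set z : Fin (dim n) := ⟨0, by omega⟩ with hz
  have hsum : ∀ r, preparedState n r = ((1 / Real.sqrt n : ℝ) : ℂ) *
      ∑ i ∈ Finset.range n, ket n (4 * i) r := by
    intro r; simp [preparedState]
  have hconj : ∀ r, starRingEnd ℂ (preparedState n r) = preparedState n r := by
    intro r
    simp [hsum, ket]
  have hket : ∀ i ∈ Finset.range n, ∀ h, preparedState n ⟨4 * i, h⟩ =
      ((1 / Real.sqrt n : ℝ) : ℂ) := by
    intro i hi h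
    rw [hsum, Finset.sum_eq_single i]
    · simp [ket]
    · intro b _ hb
      simp [ket]; omega
    · intro h; exact absurd hi h
  have hsq : ((1 / Real.sqrt n : ℝ) : ℂ) * ((1 / Real.sqrt n : ℝ) : ℂ) * n = 1 := by
    rw [← Complex.ofReal_mul, div_mul_div_comm, Real.mul_self_sqrt (Nat.cast_nonneg n)]
    push_cast
    field_simp
  have hnorm : ∑ r, preparedState n r * preparedState n r = 1 := by
    calc ∑ r, preparedState n r * preparedState n r
        = ((1 / Real.sqrt n : ℝ) : ℂ) *
          ∑ i ∈ Finset.range n, ∑ r, preparedState n r * ket n (4 * i) r := by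
          rw [Finset.sum_comm, Finset.mul_sum]
          refine Finset.sum_congr rfl fun r _ => ?_
          rw [← Finset.mul_sum]
          nth_rewrite 2 [hsum]
          ring
      _ = ((1 / Real.sqrt n : ℝ) : ℂ) *
          ∑ i ∈ Finset.range n, ((1 / Real.sqrt n : ℝ) : ℂ) := by
          congr 1
          refine Finset.sum_congr rfl fun i hi => ?_
          rw [sum_ket n _ _ (hlt i hi), hket i hi]
      _ = 1 := by
          rw [Finset.sum_const, Finset.card_range, nsmul_eq_mul, ← hsq]
          ring
  have hv : Orthonormal ℂ (({z} : Set (Fin (dim n))).domRestrict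
      fun _ => (WithLp.toLp 2 (preparedState n) : EuclideanSpace ℂ (Fin (dim n)))) := by
    rw [orthonormal_iff_ite]
    rintro ⟨i, hi⟩ ⟨j, hj⟩
    have hi' : i = z := hi
    have hj' : j = z := hj
    subst hi' hj'
    simp only [Set.domRestrict_apply, if_true, PiLp.inner_apply, RCLike.inner_apply, hconj]
    exact hnorm
  obtain ⟨b, hb⟩ := hv.exists_orthonormalBasis_extension_of_card_eq (by simp)
  refine ⟨(EuclideanSpace.basisFun (Fin (dim n)) ℂ).toBasis.toMatrix b,
    OrthonormalBasis.toMatrix_orthonormalBasis_mem_unitary _ _, ?_⟩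
  ext r
  rw [Matrix.mulVec, dotProduct, sum_ket n _ 0 (by omega)]
  have := hb z rfl
  simp only [Module.Basis.toMatrix_apply, hz] at this ⊢
  rw [this]
  simp

/-- The probability that a measurement of the state `φ` in the computational basis yields a
number in `S`. -/
def measureProb {D : ℕ} (φ : Fin D → ℂ) (S : Finset ℕ) : ℝ :=
  ∑ r : Fin D, if (r : ℕ) ∈ S then ‖φ r‖ ^ 2 else 0

/-- The probability `P_m^{n,θ}(x, z)` that measuring `U_θ(x, z) V |0⟩` yields a number in
`{m, 4 + m, …, 4 (n - 1) + m}`. -/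
def outputProb {N d n : ℕ} (V : Matrix (Fin (dim n)) (Fin (dim n)) ℂ) (θ : Params N d n)
    (m : ℕ) (p : StateInput N d) : ℝ :=
  measureProb ((gateU θ p * V).mulVec (ket n 0)) ((Finset.range n).image fun i => 4 * i + m)

/-- The network output `Fbar_R^{n,θ}(x, z)`, with components
`R - 2 R (P_1^{n,θ^j}(x, z) + P_2^{n,θ^j}(x, z))`. -/
def qnn {N d n : ℕ} (V : Matrix (Fin (dim n)) (Fin (dim n)) ℂ) (R : ℝ)
    (θ : Fin N → Params N d n) (p : StateInput N d) : EuclideanSpace ℝ (Fin N) :=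
  WithLp.toLp 2 fun j => R - 2 * R * (outputProb V (θ j) 1 p + outputProb V (θ j) 2 p)

end RQNN

end

/-! With phase s = b + ⟪a, p⟫, a block contributes (cos²(s/2) sin²(γ/2) + sin²(s/2) cos²(γ/2))/n =
(1 - cos γ cos s)/(2n) to P₁ + P₂. Hence the network is the cosine sum (R/n) ∑ cos γᵢ cos sᵢ
(`qnn_apply`). As cos γᵢ ranges over [-1, 1] and R is free, every finite cosine sum occurs
(`exists_qnn_eq`).

It remains to show that cosine sums are C¹-dense on compact sets. They form an algebra, so they
contain the powers of a trigonometric polynomial with a strict peak at 0; normalized, these are an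
approximate identity. Convolving them with a compactly supported f stays in the span, and the
derivative can be put on f, so values and derivatives converge together
(`exists_mem_cosineSpan_of_hasCompactSupport`). A cutoff removes the support condition. -/

open MeasureTheory Filter Topology Metric
open scoped Convolution

/-! ### The algebra of cosine sums -/

section CosineSpan

variable {E : Type*} [NormedAddCommGroup E] [InnerProductSpace ℝ E]

/-- The linear span of the functions `y ↦ cos (⟪a, y⟫ + b)`. -/
def cosineSpan (E : Type*) [NormedAddCommGroup E] [InnerProductSpace ℝ E] :
    Submodule ℝ (E → ℝ) :=
  Submodule.span ℝ (Set.range fun (t : E × ℝ) (y : E) => Real.cos (inner ℝ t.1 y + t.2))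

lemma cos_mem_cosineSpan (a : E) (b : ℝ) :
    (fun y => Real.cos (inner ℝ a y + b)) ∈ cosineSpan E :=
  Submodule.subset_span ⟨(a, b), rfl⟩

lemma one_mem_cosineSpan : (1 : E → ℝ) ∈ cosineSpan E := by
  convert cos_mem_cosineSpan (0 : E) 0 using 1
  ext y
  simp

/-- The product-to-sum formula on generators, extended bilinearly; it is what puts powers of the
peak function in the span. -/
lemma mul_mem_cosineSpan {f g : E → ℝ} (hf : f ∈ cosineSpan E) (hg : g ∈ cosineSpan E) :
    f * g ∈ cosineSpan E := by
  induction hf, hg using Submodule.span_induction₂ with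
  | mem_mem x y hx hy =>
    obtain ⟨⟨a, b⟩, rfl⟩ := hx
    obtain ⟨⟨a', b'⟩, rfl⟩ := hy
    convert (cosineSpan E).smul_mem (1 / 2 : ℝ) ((cosineSpan E).add_mem
      (cos_mem_cosineSpan (a + a') (b + b')) (cos_mem_cosineSpan (a - a') (b - b'))) using 1
    ext y
    simp only [Pi.mul_apply, Pi.smul_apply, Pi.add_apply, smul_eq_mul, inner_add_left,
      inner_sub_left]
    rw [show inner ℝ a y + inner ℝ a' y + (b + b') = (inner ℝ a y + b) + (inner ℝ a' y + b') by
      ring, show inner ℝ a y - inner ℝ a' y + (b - b') = (inner ℝ a y + b) - (inner ℝ a' y + b') by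
      ring, Real.cos_add (inner ℝ a y + b), Real.cos_sub (inner ℝ a y + b)]
    ring
  | zero_left y hy => rw [zero_mul]; exact zero_mem _
  | zero_right x hx => rw [mul_zero]; exact zero_mem _
  | add_left x y z _ _ _ h₁ h₂ => rw [add_mul]; exact add_mem h₁ h₂
  | add_right x y z _ _ _ h₁ h₂ => rw [mul_add]; exact add_mem h₁ h₂
  | smul_left r x y _ _ h => rw [smul_mul_assoc]; exact Submodule.smul_mem _ r h
  | smul_right r x y _ _ h => rw [mul_smul_comm]; exact Submodule.smul_mem _ r h

lemma pow_mem_cosineSpan {f : E → ℝ} (hf : f ∈ cosineSpan E) (n : ℕ) :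
    f ^ n ∈ cosineSpan E := by
  induction n with
  | zero => rw [pow_zero]; exact one_mem_cosineSpan
  | succ n ih => rw [pow_succ]; exact mul_mem_cosineSpan ih hf

lemma contDiff_of_mem_cosineSpan {f : E → ℝ} (hf : f ∈ cosineSpan E) : ContDiff ℝ 1 f := by
  induction hf using Submodule.span_induction with
  | mem x hx =>
    obtain ⟨⟨a, b⟩, rfl⟩ := hx
    exact Real.contDiff_cos.comp ((contDiff_const.inner ℝ contDiff_id).add contDiff_const)
  | zero => exact contDiff_const
  | add x y _ _ hx hy => exact hx.add hy
  | smul a x _ hx => exact contDiff_const.smul hx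

/-- Every element of `cosineSpan E` is a cosine sum of any sufficiently large length. -/
lemma exists_sum_cos_of_mem_cosineSpan {f : E → ℝ} (hf : f ∈ cosineSpan E) :
    ∃ n₀ : ℕ, ∀ n ≥ n₀, ∃ (c : Fin n → ℝ) (a : Fin n → E) (b : Fin n → ℝ),
      ∀ y, f y = ∑ i, c i * Real.cos (inner ℝ (a i) y + b i) := by
  obtain ⟨n₀, c, g, rfl⟩ := Submodule.mem_span_set'.1 hf
  choose t ht using fun i => (g i).2
  refine ⟨n₀, fun n hn => ?_⟩
  obtain ⟨k, rfl⟩ := Nat.exists_eq_add_of_le hn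
  -- Padding with zero coefficients later lets all components share one length.
  refine ⟨Fin.append c 0, Fin.append (fun i => (t i).1) 0, Fin.append (fun i => (t i).2) 0,
    fun y => ?_⟩
  simp only [Fin.sum_univ_add, Fin.append_left, Fin.append_right, Pi.zero_apply, zero_mul,
    Finset.sum_const_zero, add_zero, Finset.sum_apply, Pi.smul_apply, smul_eq_mul]
  exact Finset.sum_congr rfl fun i _ => by rw [← ht i]

/-! ### A peak function in the span -/

variable [FiniteDimensional ℝ E]

/-- The function `1 + ∑ i, (1 + cos (h yᵢ))`, the `yᵢ` being coordinates in an orthonormal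
basis. -/
noncomputable def cosineBump (E : Type*) [NormedAddCommGroup E] [InnerProductSpace ℝ E] [FiniteDimensional ℝ E]
    (h : ℝ) (y : E) : ℝ :=
  1 + ∑ i, (1 + Real.cos (h * inner ℝ (stdOrthonormalBasis ℝ E i) y))

lemma cosineBump_mem_cosineSpan (h : ℝ) : cosineBump E h ∈ cosineSpan E := by
  have : cosineBump E h = 1 + ∑ i, (1 + fun y => Real.cos
      (inner ℝ (h • stdOrthonormalBasis ℝ E i) y + 0)) := by
    ext y
    simp [cosineBump, inner_smul_left]
  rw [this]
  exact add_mem one_mem_cosineSpan (sum_mem fun i _ =>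
    add_mem one_mem_cosineSpan (cos_mem_cosineSpan _ _))

lemma cosineBump_nonneg (h : ℝ) (y : E) : 0 ≤ cosineBump E h y := by
  have : ∀ i, 0 ≤ 1 + Real.cos (h * inner ℝ (stdOrthonormalBasis ℝ E i) y) := fun i => by
    linarith [Real.neg_one_le_cos (h * inner ℝ (stdOrthonormalBasis ℝ E i) y)]
  exact add_nonneg zero_le_one (Finset.sum_nonneg fun i _ => this i)

/-- Some coordinate of y is nonzero, and its angle lies in [-π, π], where the cosine equals 1 only
at 0. -/
lemma cosineBump_lt {h : ℝ} (hh : 0 < h) {y : E} (hy : h * ‖y‖ ≤ Real.pi) (hy0 : y ≠ 0) :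
    cosineBump E h y < cosineBump E h 0 := by
  obtain ⟨i, hi⟩ : ∃ i, inner ℝ (stdOrthonormalBasis ℝ E i) y ≠ 0 := by
    by_contra! H
    exact hy0 (by rw [← (stdOrthonormalBasis ℝ E).sum_repr' y]; simp [H])
  unfold cosineBump
  refine add_lt_add_right (Finset.sum_lt_sum (fun j _ => ?_) ⟨i, Finset.mem_univ _, ?_⟩) _
  · simpa using Real.cos_le_one _
  · simp only [inner_zero_right, mul_zero, Real.cos_zero]
    refine add_lt_add_right ((Real.cos_le_one _).lt_of_ne fun hc => ?_) _
    have hb : |h * inner ℝ (stdOrthonormalBasis ℝ E i) y| ≤ Real.pi := by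
      rw [abs_mul, abs_of_pos hh]
      refine le_trans ?_ hy
      gcongr
      simpa using abs_real_inner_le_norm (stdOrthonormalBasis ℝ E i) y
    have := abs_le.1 hb
    rw [Real.cos_eq_one_iff_of_lt_of_lt (by linarith [Real.pi_pos]) (by linarith [Real.pi_pos])]
      at hc
    exact mul_ne_zero hh.ne' hi hc

/-! ### Convolution and C¹ density -/

variable [MeasurableSpace E] [BorelSpace E]

/-- The addition formula separates y from t in cos(⟪a, y - t⟫ + b), leaving two constants as
integrals over t; a shift by π/2 writes the sine as a cosine. -/
lemma convolution_mem_cosineSpan {f : E → ℝ} (hf : Continuous f) (hcf : HasCompactSupport f)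
    {g : E → ℝ} (hg : g ∈ cosineSpan E) :
    (f ⋆[ContinuousLinearMap.lsmul ℝ ℝ, (volume : Measure E)] g) ∈ cosineSpan E := by
  have hex : ∀ g ∈ cosineSpan E, ConvolutionExists f g (ContinuousLinearMap.lsmul ℝ ℝ)
      (volume : Measure E) := fun g hg =>
    hcf.convolutionExists_left _ hf (contDiff_of_mem_cosineSpan hg).continuous.locallyIntegrable
  induction hg using Submodule.span_induction with
  | mem x hx =>
    obtain ⟨⟨a, b⟩, rfl⟩ := hx
    have hint : ∀ u : E → ℝ, Continuous u → Integrable (fun t => f t * u t) := fun u hu =>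
      (hf.mul hu).integrable_of_hasCompactSupport hcf.mul_right
    have h₁ := hint (fun t => Real.cos (inner ℝ a t)) (by fun_prop)
    have h₂ := hint (fun t => Real.sin (inner ℝ a t)) (by fun_prop)
    convert (cosineSpan E).add_mem
      ((cosineSpan E).smul_mem (∫ t, f t * Real.cos (inner ℝ a t)) (cos_mem_cosineSpan a b))
      ((cosineSpan E).smul_mem (∫ t, f t * Real.sin (inner ℝ a t))
        (cos_mem_cosineSpan a (b - Real.pi / 2))) using 1
    ext y
    rw [convolution_lsmul]
    simp only [Pi.add_apply, Pi.smul_apply, smul_eq_mul]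
    rw [← integral_mul_const, ← integral_mul_const,
      ← integral_add (h₁.mul_const _) (h₂.mul_const _)]
    congr 1
    ext t
    rw [← add_sub_assoc, Real.cos_sub_pi_div_two, inner_sub_right,
      show inner ℝ a y - inner ℝ a t + b = (inner ℝ a y + b) - inner ℝ a t by ring, Real.cos_sub]
    ring
  | zero => rw [convolution_zero]; exact zero_mem _
  | add x y hx hy ihx ihy => rw [(hex x hx).distrib_add (hex y hy)]; exact add_mem ihx ihy
  | smul r x _ ih => rw [convolution_smul]; exact Submodule.smul_mem _ r ih

/-- Convolution with normalized powers of a function with a unique maximum at `0` converges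
uniformly on compact sets. -/
lemma tendstoUniformlyOn_setIntegral_pow_smul {F : Type*} [NormedAddCommGroup F]
    [NormedSpace ℝ F] [CompleteSpace F] {s X : Set E} (hs : IsCompact s) (hX : IsCompact X)
    {c : E → ℝ} (hc : Continuous c) (hmax : ∀ y ∈ s, y ≠ 0 → c y < c 0)
    (hnonneg : ∀ y ∈ s, 0 ≤ c y) (hpos : 0 < c 0) (h0 : (0 : E) ∈ interior s)
    {k : E → F} (hk : Continuous k) :
    TendstoUniformlyOn
      (fun (n : ℕ) y => (∫ t in s, c t ^ n)⁻¹ • ∫ t in s, c t ^ n • k (y - t)) k atTop X := by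
  have : CompactSpace X := isCompact_iff_compactSpace.1 hX
  -- Taking values in C(X, F) turns the pointwise peak theorem at 0 into uniform convergence on X.
  let G : C(E, C(X, F)) := ContinuousMap.curry ⟨fun q : E × X => k (q.2 - q.1), by fun_prop⟩
  have hint : ∀ n : ℕ, IntegrableOn (fun t => c t ^ n • G t) s := fun n =>
    ((hc.pow n).smul G.continuous).continuousOn.integrableOn_compact hs
  have key := tendsto_setIntegral_pow_smul_of_unique_maximum_of_isCompact_of_continuousOn
    (μ := (volume : Measure E)) hs hc.continuousOn hmax hnonneg hpos
    (subset_closure h0) G.continuous.continuousOn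
  rw [Metric.tendsto_atTop] at key
  rw [Metric.tendstoUniformlyOn_iff]
  intro ε hε
  obtain ⟨N, hN⟩ := key ε hε
  filter_upwards [eventually_ge_atTop N] with n hn y hy
  have h := (ContinuousMap.dist_apply_le_dist (⟨y, hy⟩ : X)).trans_lt (hN n hn)
  rw [dist_comm]
  have e : (∫ t in s, c t ^ n • G t) ⟨y, hy⟩ = ∫ t in s, c t ^ n • k (y - t) := by
    have := (ContinuousMap.evalCLM ℝ (⟨y, hy⟩ : X) : C(X, F) →L[ℝ] F).integral_comp_comm (hint n)
    exact this.symm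
  simpa [e, G] using h

/-- If y and y - t both have norm at most r, then ‖t‖ ≤ 2r, so the truncation loses nothing; then
substitute t ↦ y - t. -/
lemma setIntegral_closedBall_smul_comp_sub {G : Type*} [NormedAddCommGroup G] [NormedSpace ℝ G]
    {k : E → G} {r : ℝ} (hk : tsupport k ⊆ closedBall 0 r) {y : E} (hy : y ∈ closedBall 0 r)
    (φ : E → ℝ) :
    ∫ t in closedBall 0 (2 * r), φ t • k (y - t) = ∫ t, φ (y - t) • k t := by
  rw [setIntegral_eq_integral_of_forall_compl_eq_zero,
    ← integral_sub_left_eq_self (fun t => φ t • k (y - t)) _ y]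
  · simp only [sub_sub_cancel]
  intro t ht
  by_contra hne
  have hkt : y - t ∈ tsupport k := subset_closure fun h0 => hne (by rw [h0, smul_zero])
  have h₁ : ‖y‖ ≤ r := mem_closedBall_zero_iff.1 hy
  have h₂ : ‖y - t‖ ≤ r := mem_closedBall_zero_iff.1 (hk hkt)
  refine ht (mem_closedBall_zero_iff.2 ?_)
  calc ‖t‖ = ‖y - (y - t)‖ := by rw [sub_sub_cancel]
    _ ≤ ‖y‖ + ‖y - t‖ := norm_sub_le _ _
    _ ≤ 2 * r := by linarith

/-- `cosineSpan E` is dense, in the `C¹` sense on compact sets, in the compactly supported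
`C¹` functions. -/
lemma exists_mem_cosineSpan_of_hasCompactSupport {f : E → ℝ} (hf : ContDiff ℝ 1 f)
    (hcf : HasCompactSupport f) {X : Set E} (hX : IsCompact X) {ε : ℝ} (hε : 0 < ε) :
    ∃ g ∈ cosineSpan E, ∀ y ∈ X, |f y - g y| < ε ∧ ‖fderiv ℝ f y - fderiv ℝ g y‖ < ε := by
  obtain ⟨r, hr, hsub⟩ := ((hX.union hcf).isBounded).subset_closedBall_lt 0 (0 : E)
  -- This frequency keeps the angles within [-π, π] on the ball of radius 2r, so 0 is the only peak
  -- there.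
  set h : ℝ := Real.pi / (2 * r) with hh
  have hhpos : 0 < h := by positivity
  set s : Set E := closedBall 0 (2 * r) with hs
  have hmax : ∀ y ∈ s, y ≠ 0 → cosineBump E h y < cosineBump E h 0 := by
    intro y hy hy0
    refine cosineBump_lt hhpos ?_ hy0
    rw [hs, mem_closedBall_zero_iff] at hy
    calc h * ‖y‖ ≤ h * (2 * r) := by gcongr
      _ = Real.pi := by rw [hh]; field_simp
  have hc : Continuous (cosineBump E h) :=
    (contDiff_of_mem_cosineSpan (cosineBump_mem_cosineSpan h)).continuous
  -- The leading 1 of `cosineBump` covers the zero-dimensional case.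
  have hpos : 0 < cosineBump E h 0 := by
    unfold cosineBump
    simp only [inner_zero_right, mul_zero, Real.cos_zero]
    positivity
  have h0 : (0 : E) ∈ interior s :=
    ball_subset_interior_closedBall (mem_ball_self (by positivity))
  have hscomp : IsCompact s := isCompact_closedBall _ _
  have u₁ := tendstoUniformlyOn_setIntegral_pow_smul hscomp hX hc hmax
    (fun y _ => cosineBump_nonneg h y) hpos h0 hf.continuous
  have u₂ := tendstoUniformlyOn_setIntegral_pow_smul hscomp hX hc hmax
    (fun y _ => cosineBump_nonneg h y) hpos h0 (hf.continuous_fderiv one_ne_zero)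
  have hXr : X ⊆ closedBall 0 r := Set.subset_union_left.trans hsub
  have hfr : tsupport f ⊆ closedBall 0 r := Set.subset_union_right.trans hsub
  have hfr' : tsupport (fderiv ℝ f) ⊆ closedBall 0 r := (tsupport_fderiv_subset ℝ).trans hfr
  rw [Metric.tendstoUniformlyOn_iff] at u₁ u₂
  obtain ⟨n, h₁, h₂⟩ := ((u₁ ε hε).and (u₂ ε hε)).exists
  have hpow : cosineBump E h ^ n ∈ cosineSpan E :=
    pow_mem_cosineSpan (cosineBump_mem_cosineSpan h) n
  refine ⟨(∫ t in s, cosineBump E h t ^ n)⁻¹ •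
    (f ⋆[ContinuousLinearMap.lsmul ℝ ℝ, (volume : Measure E)] (cosineBump E h ^ n)),
    Submodule.smul_mem _ _ (convolution_mem_cosineSpan hf.continuous hcf hpow),
    fun y hy => ⟨?_, ?_⟩⟩
  · have := h₁ y hy
    rw [setIntegral_closedBall_smul_comp_sub hfr (hXr hy) (fun t => cosineBump E h t ^ n),
      Real.dist_eq] at this
    convert this using 4
    rw [Pi.smul_apply, convolution_lsmul]
    simp [mul_comm]
  · have := h₂ y hy
    rw [setIntegral_closedBall_smul_comp_sub (k := fderiv ℝ f) hfr' (hXr hy)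
      (fun t => cosineBump E h t ^ n), dist_eq_norm] at this
    -- Differentiating the factor f gives `fderiv ℝ f` smoothed by the same kernel, to which `u₂`
    -- applies.
    have hd := hcf.hasFDerivAt_convolution_left (μ := (volume : Measure E))
      (ContinuousLinearMap.lsmul ℝ ℝ) hf
      (contDiff_of_mem_cosineSpan hpow).continuous.locallyIntegrable y
    have heq : (fderiv ℝ f ⋆[(ContinuousLinearMap.lsmul ℝ ℝ).precompL E,
        (volume : Measure E)] (cosineBump E h ^ n)) y =
        ∫ t, cosineBump E h (y - t) ^ n • fderiv ℝ f t := by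
      rw [convolution_def]
      congr 1
      ext t v
      simp [ContinuousLinearMap.precompL_apply, mul_comm]
    rw [heq] at hd
    rw [(hd.const_smul _).fderiv]
    exact this

/-- `cosineSpan E` is dense in the `C¹` functions, in the `C¹` sense on compact sets. -/
lemma exists_mem_cosineSpan_approx {f : E → ℝ} (hf : ContDiff ℝ 1 f)
    {X : Set E} (hX : IsCompact X) {ε : ℝ} (hε : 0 < ε) :
    ∃ g ∈ cosineSpan E, ∀ y ∈ X, |f y - g y| < ε ∧ ‖fderiv ℝ f y - fderiv ℝ g y‖ < ε := by
  obtain ⟨r, hr, hsub⟩ := hX.isBounded.subset_closedBall_lt 0 (0 : E)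
  -- The margin makes χ equal to 1 near each point of X, so derivatives agree too.
  let χ : ContDiffBump (0 : E) := ⟨r + 1, r + 2, by linarith, by linarith⟩
  obtain ⟨g, hg, hfg⟩ := exists_mem_cosineSpan_of_hasCompactSupport (χ.contDiff.mul hf)
    χ.hasCompactSupport.mul_right hX hε
  refine ⟨g, hg, fun y hy => ?_⟩
  have heq : (fun y => χ y * f y) =ᶠ[𝓝 y] f := by
    have : y ∈ ball (0 : E) χ.rIn := by
      have := mem_closedBall.1 (hsub hy)
      exact mem_ball.2 (by change _ < r + 1; linarith)
    filter_upwards [χ.eventuallyEq_one_of_mem_ball this] with z hz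
    simp [hz]
  have := hfg y hy
  rwa [heq.fderiv_eq, heq.eq_of_nhds] at this

end CosineSpan

/-! ### Amplitudes and output probabilities of the circuit -/

namespace RQNN

/-- The argument `b + ∑ k, aₖ yₖ` of the rotation in one block. -/
noncomputable def blockPhase {N d : ℕ} (t : BlockParams N d) (p : StateInput N d) : ℝ :=
  t.b + ∑ k : Fin (N + d), t.a k * Fin.append (fun l => p.fst l) (fun l => p.snd l) k

lemma Rz_add (α β : ℝ) : Rz (α + β) = Rz α * Rz β := by
  ext i j
  fin_cases i <;> fin_cases j <;>
    simp [Rz, Matrix.mul_apply, ← Complex.exp_add] <;> ring_nf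

lemma Rz_zero : Rz 0 = 1 := by
  ext i j
  fin_cases i <;> fin_cases j <;> simp [Rz]

lemma prod_map_Rz (l : List ℝ) : (l.map Rz).prod = Rz l.sum := by
  induction l with
  | nil => simp [Rz_zero]
  | cons a l ih => simp [ih, Rz_add]

/-- `Rz` is a one-parameter group, so the chain of rotations merges and its order is irrelevant. -/
lemma gateU₁_eq {N d : ℕ} (t : BlockParams N d) (p : StateInput N d) :
    gateU₁ t p = hadamard * Rz (-blockPhase t p) * hadamard := by
  unfold gateU₁ blockPhase
  rw [show (fun k : Fin (N + d) =>
      Rz (-(t.a k * Fin.append (fun l => p.fst l) (fun l => p.snd l) k))) =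
      Rz ∘ fun k => -(t.a k * Fin.append (fun l => p.fst l) (fun l => p.snd l) k) from rfl,
    ← List.map_ofFn, ← List.map_reverse, prod_map_Rz, List.sum_reverse, List.sum_ofFn,
    Finset.sum_neg_distrib, mul_assoc hadamard, ← Rz_add, neg_add]

lemma hadamard_Rz_hadamard (s : ℝ) :
    (hadamard * Rz (-s) * hadamard) 0 0 = (Real.cos (s / 2) : ℂ) ∧
      (hadamard * Rz (-s) * hadamard) 1 0 = Complex.I * (Real.sin (s / 2) : ℂ) := by
  have h2 : ((Real.sqrt 2 : ℝ) : ℂ)⁻¹ * ((Real.sqrt 2 : ℝ) : ℂ)⁻¹ = 1 / 2 := by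
    rw [← mul_inv, ← Complex.ofReal_mul, Real.mul_self_sqrt zero_le_two]
    norm_num
  have hc := Complex.two_cos (s / 2 : ℂ)
  have hs := Complex.two_sin (s / 2 : ℂ)
  push_cast
  constructor
  · simp only [hadamard, Rz, Matrix.mul_apply, Fin.sum_univ_two, Matrix.smul_apply]
    simp
    rw [show -(Complex.I * (-(s : ℂ) / 2)) = (s / 2 : ℂ) * Complex.I by ring,
      show Complex.I * (-(s : ℂ) / 2) = -(s / 2 : ℂ) * Complex.I by ring]
    linear_combination (-1/2 : ℂ) * hc + (Complex.exp (s / 2 * Complex.I) +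
      Complex.exp (-(s / 2) * Complex.I)) * h2
  · simp only [hadamard, Rz, Matrix.mul_apply, Fin.sum_univ_two, Matrix.smul_apply]
    simp
    rw [show -(Complex.I * (-(s : ℂ) / 2)) = (s / 2 : ℂ) * Complex.I by ring,
      show Complex.I * (-(s : ℂ) / 2) = -(s / 2 : ℂ) * Complex.I by ring]
    linear_combination (-Complex.I/2 : ℂ) * hs + (Complex.exp (s / 2 * Complex.I) -
      Complex.exp (-(s / 2) * Complex.I)) * h2 + (1 / 2 : ℂ) * (Complex.exp (s / 2 * Complex.I) -
      Complex.exp (-(s / 2) * Complex.I)) * Complex.I_sq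

lemma gateUbar_one_zero {N d : ℕ} (t : BlockParams N d) (p : StateInput N d) :
    gateUbar t p 1 0 =
      (Real.cos (blockPhase t p / 2) : ℂ) * (Real.sin (t.γ / 2) : ℂ) := by
  have h : gateUbar t p 1 0 = gateU₁ t p 0 0 * gateU₂ t 1 0 := rfl
  rw [h, gateU₁_eq, (hadamard_Rz_hadamard _).1]
  simp [gateU₂, Ry]

lemma gateUbar_two_zero {N d : ℕ} (t : BlockParams N d) (p : StateInput N d) :
    gateUbar t p 2 0 =
      Complex.I * (Real.sin (blockPhase t p / 2) : ℂ) * (Real.cos (t.γ / 2) : ℂ) := by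
  have h : gateUbar t p 2 0 = gateU₁ t p 1 0 * gateU₂ t 0 0 := rfl
  rw [h, gateU₁_eq, (hadamard_Rz_hadamard _).2]
  simp [gateU₂, Ry]

lemma indexEquiv_inl_val {n : ℕ} (k : Fin 4) (i : Fin n) :
    (indexEquiv n (Sum.inl (k, i)) : ℕ) = 4 * i + k := by
  change (k : ℕ) + 4 * i = _
  rw [add_comm]

lemma indexEquiv_inr_val {n : ℕ} (l : Fin (padding n)) :
    (indexEquiv n (Sum.inr l) : ℕ) = 4 * n + l := by
  change n * 4 + (l : ℕ) = _
  rw [mul_comm]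

lemma preparedState_inl {n : ℕ} (k : Fin 4) (i : Fin n) :
    preparedState n (indexEquiv n (Sum.inl (k, i))) =
      if k = 0 then ((1 / Real.sqrt n : ℝ) : ℂ) else 0 := by
  simp only [preparedState, Pi.smul_apply, Finset.sum_apply, ket, indexEquiv_inl_val, smul_eq_mul]
  split_ifs with hk
  · rw [Finset.sum_eq_single (i : ℕ)]
    · simp [hk]
    · intro b _ hb
      rw [if_neg]
      subst hk
      simp only [Fin.val_zero, add_zero]
      omega
    · intro h
      exact absurd (Finset.mem_range.2 i.2) h
  · rw [Finset.sum_eq_zero, mul_zero]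
    intro b _
    rw [if_neg]
    have := k.2
    have : (k : ℕ) ≠ 0 := fun h => hk (Fin.ext h)
    omega

lemma preparedState_inr {n : ℕ} (l : Fin (padding n)) :
    preparedState n (indexEquiv n (Sum.inr l)) = 0 := by
  simp only [preparedState, Pi.smul_apply, Finset.sum_apply, ket, indexEquiv_inr_val, smul_eq_mul]
  rw [Finset.sum_eq_zero, mul_zero]
  intro b hb
  have := Finset.mem_range.1 hb
  rw [if_neg]
  omega

lemma gateU_mulVec_preparedState {N d n : ℕ} (θ : Params N d n) (p : StateInput N d)
    (k : Fin 4) (i : Fin n) :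
    (gateU θ p).mulVec (preparedState n) (indexEquiv n (Sum.inl (k, i))) =
      gateUbar (θ i) p k 0 * ((1 / Real.sqrt n : ℝ) : ℂ) := by
  rw [Matrix.mulVec, dotProduct, ← Equiv.sum_comp (indexEquiv n), Fintype.sum_sum_type,
    Fintype.sum_prod_type]
  simp only [preparedState_inl, preparedState_inr, mul_zero, Finset.sum_const_zero, add_zero]
  rw [Finset.sum_eq_single 0 (fun k' _ hk' => by simp [hk']) (by simp),
    Finset.sum_eq_single i _ (by simp)]
  · simp [gateU, Matrix.blockDiagonal_apply]
  · intro i' _ hi'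
    simp [gateU, Matrix.blockDiagonal_apply, hi'.symm]

/-- The prepared state has amplitude 1/√n at index 0 of each block and vanishes elsewhere, so only
the first column of each block is seen. -/
lemma outputProb_eq {N d n : ℕ} {V : Matrix (Fin (dim n)) (Fin (dim n)) ℂ}
    (hV : IsPreparationGate n V) (θ : Params N d n) (m : Fin 4) (p : StateInput N d) :
    outputProb V θ m p = (∑ i, ‖gateUbar (θ i) p m 0‖ ^ 2) / n := by
  rw [outputProb, measureProb, ← Matrix.mulVec_mulVec, hV.2, ← Equiv.sum_comp (indexEquiv n),
    Fintype.sum_sum_type, Fintype.sum_prod_type]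
  simp only [indexEquiv_inl_val, indexEquiv_inr_val, Finset.mem_image, Finset.mem_range,
    gateU_mulVec_preparedState]
  have hm := m.2
  rw [Finset.sum_eq_single m _ (by simp), Finset.sum_eq_zero (s := Finset.univ
    (α := Fin (padding n))), add_zero, Finset.sum_div]
  · refine Finset.sum_congr rfl fun i _ => ?_
    rw [if_pos ⟨i, i.2, rfl⟩, norm_mul, mul_pow, Complex.norm_real, Real.norm_eq_abs, sq_abs,
      div_pow, Real.sq_sqrt (Nat.cast_nonneg n)]
    ring
  · intro l _
    rw [if_neg]
    rintro ⟨i, hi, h⟩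
    omega
  · intro k _ hk
    refine Finset.sum_eq_zero fun i _ => if_neg ?_
    rintro ⟨i', hi', h⟩
    have := k.2
    exact hk (Fin.ext (by omega))

/-- The network output is a cosine sum. -/
lemma qnn_apply {N d n : ℕ} (hn : 0 < n) {V : Matrix (Fin (dim n)) (Fin (dim n)) ℂ}
    (hV : IsPreparationGate n V) (R : ℝ) (θ : Fin N → Params N d n) (p : StateInput N d)
    (j : Fin N) :
    qnn V R θ p j =
      ∑ i, R / n * Real.cos (θ j i).γ * Real.cos (blockPhase (θ j i) p) := by
  have hn' : (n : ℝ) ≠ 0 := by exact_mod_cast hn.ne'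
  have h₁ := outputProb_eq hV (θ j) 1 p
  have h₂ := outputProb_eq hV (θ j) 2 p
  have hR : R = ∑ _i : Fin n, R / n := by
    simp
    field_simp
  simp only [Fin.val_one, Fin.val_two] at h₁ h₂
  change R - 2 * R * (outputProb V (θ j) 1 p + outputProb V (θ j) 2 p) = _
  rw [h₁, h₂, ← add_div, ← Finset.sum_add_distrib, mul_div_assoc', mul_comm (2 * R),
    mul_div_assoc, Finset.sum_mul]
  nth_rewrite 1 [hR]
  rw [← Finset.sum_sub_distrib]
  refine Finset.sum_congr rfl fun i _ => ?_
  rw [gateUbar_one_zero, gateUbar_two_zero]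
  simp only [norm_mul, Complex.norm_I, one_mul, Complex.norm_real, Real.norm_eq_abs, mul_pow,
    sq_abs]
  set γ := (θ j i).γ
  set s := blockPhase (θ j i) p
  have hγ : Real.cos γ = 2 * Real.cos (γ / 2) ^ 2 - 1 := by rw [← Real.cos_two_mul]; ring_nf
  have hs : Real.cos s = 2 * Real.cos (s / 2) ^ 2 - 1 := by rw [← Real.cos_two_mul]; ring_nf
  rw [hγ, hs, Real.sin_sq, Real.sin_sq]
  ring

end RQNN

/-! ### Realizing cosine sums by networks -/

namespace RQNN

/-- The block parameters whose phase is `⟪a, p⟫ + b`. -/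
noncomputable def blockParamsOf {N d : ℕ} (c : ℝ) (a : StateInput N d) (b : ℝ) :
    BlockParams N d where
  a := Fin.append (fun l => a.fst l) (fun l => a.snd l)
  b := b
  γ := Real.arccos c
  γ_mem := ⟨Real.arccos_nonneg c, (Real.arccos_le_pi c).trans (by linarith [Real.pi_pos])⟩

lemma blockPhase_blockParamsOf {N d : ℕ} (c : ℝ) (a : StateInput N d) (b : ℝ)
    (p : StateInput N d) : blockPhase (blockParamsOf c a b) p = inner ℝ a p + b := by
  simp [blockPhase, blockParamsOf, Fin.sum_univ_add, WithLp.prod_inner_apply, PiLp.inner_apply,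
    mul_comm, add_comm]

/-- Finitely many functions in the cosine span are the components of one network. -/
lemma exists_qnn_eq {N d : ℕ} {g : Fin N → StateInput N d → ℝ}
    (hg : ∀ j, g j ∈ cosineSpan (StateInput N d)) :
    ∃ (n : ℕ) (R : ℝ) (θ : Fin N → Params N d n), 0 < n ∧ 0 < R ∧
      ∀ V : Matrix (Fin (dim n)) (Fin (dim n)) ℂ, IsPreparationGate n V →
        ∀ j, (fun p => qnn V R θ p j) = g j := by
  choose n₀ hn₀ using fun j => exists_sum_cos_of_mem_cosineSpan (hg j)
  set n := ∑ j, n₀ j + 1 with hn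
  have hnpos : 0 < n := by omega
  choose c a b hgn using fun j => hn₀ j n
    ((Finset.single_le_sum (fun i _ => Nat.zero_le (n₀ i)) (Finset.mem_univ j)).trans
      (Nat.le_succ _))
  -- One bound for all coefficients: c/M is then the cosine of an admissible angle, and R = nM
  -- restores the scale for every component.
  set M := 1 + ∑ j, ∑ i, |c j i| with hM
  have hcM : ∀ j i, |c j i| ≤ M := fun j i =>
    calc |c j i| ≤ ∑ i, |c j i| :=
          Finset.single_le_sum (f := fun i => |c j i|) (fun _ _ => abs_nonneg _)
            (Finset.mem_univ i)
      _ ≤ ∑ j, ∑ i, |c j i| :=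
          Finset.single_le_sum (f := fun j => ∑ i, |c j i|)
            (fun _ _ => Finset.sum_nonneg fun _ _ => abs_nonneg _) (Finset.mem_univ j)
      _ ≤ M := by linarith
  have hMpos : 0 < M := by positivity
  have hn' : (0 : ℝ) < n := by exact_mod_cast hnpos
  refine ⟨n, n * M, fun j i => blockParamsOf (c j i / M) (a j i) (b j i), hnpos,
    by positivity, fun V hV j => ?_⟩
  ext p
  rw [qnn_apply hnpos hV, hgn]
  refine Finset.sum_congr rfl fun i _ => ?_
  have hle : |c j i / M| ≤ 1 := by
    rw [abs_div, abs_of_pos hMpos]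
    exact (div_le_one hMpos).2 (hcM j i)
  rw [blockPhase_blockParamsOf]
  change n * M / n * Real.cos (Real.arccos (c j i / M)) * _ = _
  rw [Real.cos_arccos (abs_le.1 hle).1 (abs_le.1 hle).2]
  field_simp

end RQNN

theorem mainTheorem4 (N d : ℕ)
    (F : RQNN.StateInput N d → EuclideanSpace ℝ (Fin N)) (hF : ContDiff ℝ 1 F)
    (ε : ℝ) (hε : 0 < ε) (X : Set (RQNN.StateInput N d)) (hX : IsCompact X) :
    ∃ (n : ℕ) (R : ℝ) (θ : Fin N → RQNN.Params N d n), 0 < n ∧ 0 < R ∧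
      ∀ V : Matrix (Fin (RQNN.dim n)) (Fin (RQNN.dim n)) ℂ, RQNN.IsPreparationGate n V →
        ∀ j : Fin N,
          Differentiable ℝ (fun p => RQNN.qnn V R θ p j) ∧
          ∀ p ∈ X,
            |F p j - RQNN.qnn V R θ p j| +
              ‖gradient (fun q => F q j) p - gradient (fun q => RQNN.qnn V R θ q j) p‖ ≤ ε := by
  choose g hg hFg using fun j : Fin N =>
    exists_mem_cosineSpan_approx ((contDiff_euclidean.1 hF) j) hX (half_pos hε)
  obtain ⟨n, R, θ, hn, hR, hθ⟩ := RQNN.exists_qnn_eq hg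
  refine ⟨n, R, θ, hn, hR, fun V hV j => ?_⟩
  have hq : ∀ p, RQNN.qnn V R θ p j = g j p := fun p => congrFun (hθ V hV j) p
  simp only [hq]
  refine ⟨(contDiff_of_mem_cosineSpan (hg j)).differentiable one_ne_zero, fun p hp => ?_⟩
  obtain ⟨h₁, h₂⟩ := hFg j p hp
  -- The Riesz isometry transfers the bound on `fderiv` to gradients.
  rw [gradient, gradient, ← map_sub, LinearIsometryEquiv.norm_map]
  linarith
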